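/- For an orientable ribbon graph $G$ with $v(G)$ vertices, $e(G)$ edges, $f(G)$ faces (boundary components) and $c(G)$ connected components, let $\gamma(G)=c(G)-\tfrac12\bigl(v(G)-e(G)+f(G)\bigr)$ be its genus, and for $A\subseteq E(G)$ let $G^{A}$ be Chmutov's partial dual of $G$ with respect to $A$. Let $\gamma_i(G)$ be the number of subsets $A\subseteq E(G)$ with $\gamma(G^{A})=i$, and let $X_G$ be a random variable with $\mathbb P(X_G=i)=\gamma_i(G)/2^{e(G)}$ for $i=0,1,2,\dots$ (the partial-dual genus distribution of $G$). For $n\ge 1$ let $N_n$ be the planar ribbon necklace graph: the graph with vertices $v_1,\dots,v_{2n}$, two parallel edges joining $v_{2i-1}$ and $v_{2i}$ for each $1\le i\le n$, one edge joining $v_{2i}$ and $v_{2i+1}$ for each $1\le i\le n-1$, and one edge joining $v_{2n}$ and $v_1$, embedded in the plane as the cycle $v_1v_2\cdots v_{2n}$ in which every edge $v_{2i-1}v_{2i}$ is doubled (for $n=1$: two vertices joined by three parallel edges). Write $X_n=X_{N_n}$, $e_n=\mathbb E(X_n)$ and $v_n=\operatorname{Var}(X_n)$. **Theorem.** The partial-dual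 genus distribution of $N_n$ is asymptotically normal with mean $\frac{n+2}{2}$ and variance $\frac n4$ as $n\to\infty$. Precisely: 1. for every $x\in\mathbb R$, $$\lim_{n\to\infty}\mathbb P\!\left(\frac{X_n-e_n}{\sqrt{v_n}}\le x\right)=\int_{-\infty}^{x}\frac1{\sqrt{2\pi}}e^{-u^2/2}\,du ;$$ 2. for every $n\ge 1$, $$e_n=\frac{n+2}{2}-2\left(\frac38\right)^{n},\qquad v_n=\frac n4+\left(2-\frac{2n}{3}\right)\left(\frac38\right)^{n}-4\left(\frac38\right)^{2n},$$ so that $e_n-\frac{n+2}{2}\to0$ and $v_n-\frac n4\to0$; 3. for every $x\in\mathbb R$, $$\lim_{n\to\infty}\mathbb P\!\left(\frac{X_n-\frac{n+2}{2}}{\sqrt{n/4}}\le x\right)=\int_{-\infty}^{x}\frac1{\sqrt{2\pi}}e^{-u^2/2}\,du .$$ -/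

import Mathlib

/-- The marked points of an arrow presentation with label set `E`: the label `e` marks two arrows
`(e, false)` and `(e, true)`; `(e, i, false)` is the tail of the arrow `(e, i)` and `(e, i, true)`
is its head. -/
abbrev MarkedPoint (E : Type) : Type := E × Bool × Bool

/-- A ribbon graph, given by its arrow presentation: a finite set of circles (the boundaries of the
vertex-disks) carrying disjoint arrows, each edge labelling exactly two of them. The ribbon `e` is
a quadrilateral glued to the circles along the two arrows labelled `e`; the boundary of the ribbon
runs from the tail to the head of one arrow, then along a side of the ribbon to the tail of the
other arrow, to its head, and back along the other side. The circles are encoded by `arc`, which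
joins two arrow ends when they bound the same unmarked arc of a circle (an arc with no arrow inside
it). The circles that carry no arrow are only counted, by `isolated`. -/
structure RibbonGraph where
  Edge : Type
  [fintypeEdge : Fintype Edge]
  [decidableEqEdge : DecidableEq Edge]
  arc : Equiv.Perm (MarkedPoint Edge)
  arc_arc : ∀ p, arc (arc p) = p
  arc_ne : ∀ p, arc p ≠ p
  isolated : ℕ

attribute [instance] RibbonGraph.fintypeEdge RibbonGraph.decidableEqEdge

namespace RibbonGraph

/-- The other end of the same arrow. -/
def arrowEnd {E : Type} : MarkedPoint E → MarkedPoint E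
  | (e, i, t) => (e, i, !t)

/-- The other end of a ribbon side: the head of one arrow labelled `e` is joined to the tail of the
other arrow labelled `e`. -/
def sideEnd {E : Type} : MarkedPoint E → MarkedPoint E
  | (e, i, t) => (e, !i, !t)

/-- The number of vertices: circles, made of arrows and unmarked arcs. -/
noncomputable def numVertices (G : RibbonGraph) : ℕ :=
  Nat.card (Quot fun p q : MarkedPoint G.Edge => q = arrowEnd p ∨ q = G.arc p) + G.isolated

/-- The number of edges. -/
def numEdges (G : RibbonGraph) : ℕ := Fintype.card G.Edge

/-- The number of faces: boundary components of the ribbon surface, made of ribbon sides and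
unmarked arcs. -/
noncomputable def numFaces (G : RibbonGraph) : ℕ :=
  Nat.card (Quot fun p q : MarkedPoint G.Edge => q = sideEnd p ∨ q = G.arc p) + G.isolated

/-- The number of connected components. -/
noncomputable def numComponents (G : RibbonGraph) : ℕ :=
  Nat.card (Quot fun p q : MarkedPoint G.Edge => q = arrowEnd p ∨ q = sideEnd p ∨ q = G.arc p)
    + G.isolated

/-- The genus `c(G) - (v(G) - e(G) + f(G)) / 2` of an orientable ribbon graph. -/
noncomputable def genus (G : RibbonGraph) : ℚ :=
  G.numComponents - ((G.numVertices : ℚ) - G.numEdges + G.numFaces) / 2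

/-- The new arrows used in the partial dual with respect to `A`, located in terms of the old ones.
For `e ∉ A` the arrows stay where they are. For `e ∈ A` the new arrows run along the two sides of
the ribbon `e`, in the direction of the boundary of the ribbon: the new arrow `(e, i)` starts at the
head of the old arrow `(e, i)` and ends at the tail of the old arrow `(e, !i)`. -/
def newArrow {E : Type} [DecidableEq E] (A : Finset E) : Equiv.Perm (MarkedPoint E) where
  toFun p := if p.1 ∈ A then (p.1, (if p.2.2 then !p.2.1 else p.2.1), !p.2.2) else p
  invFun p := if p.1 ∈ A then (p.1, (if p.2.2 then p.2.1 else !p.2.1), !p.2.2) else p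
  left_inv := by
    rintro ⟨e, i, t⟩
    by_cases h : e ∈ A <;> cases i <;> cases t <;> simp [h]
  right_inv := by
    rintro ⟨e, i, t⟩
    by_cases h : e ∈ A <;> cases i <;> cases t <;> simp [h]

/-- The partial dual `G^A`. The boundary components of the spanning ribbon subgraph `(V(G), A)` are
made of the unmarked arcs of `G`, the sides of the ribbons in `A`, and the arrows of `G` labelled
outside `A`; they meet the ribbons of `G` in the latter two kinds of pieces. Marking each of these
pieces by an arrow, directed as the boundary of the ribbon, gives the arrow presentation of
`G^A`. -/
def partialDual (G : RibbonGraph) (A : Finset G.Edge) : RibbonGraph where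
  Edge := G.Edge
  arc := (newArrow A).trans (G.arc.trans (newArrow A).symm)
  arc_arc p := by simp [G.arc_arc]
  arc_ne p h := G.arc_ne (newArrow A p) (by simpa [Equiv.symm_apply_eq] using h)
  isolated := G.isolated

/-- `γ_i(G)`: the number of edge sets `A` for which the partial dual `G^A` has genus `i`. -/
noncomputable def partialDualCount (G : RibbonGraph) (i : ℕ) : ℕ :=
  Nat.card {A : Finset G.Edge // (G.partialDual A).genus = i}

/-- The partial-dual genus distribution of `G`, as a probability measure on `ℝ`: the law of the
genus of `G^A` for a uniformly random set `A` of edges. -/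
noncomputable def genusLaw (G : RibbonGraph) : MeasureTheory.Measure ℝ :=
  ((PMF.uniformOfFintype (Finset G.Edge)).map
    fun A => ((G.partialDual A).genus : ℝ)).toMeasure

/-- The value `i` has probability `γ_i(G) / 2 ^ e(G)`. -/
theorem genusLaw_real_singleton (G : RibbonGraph) (i : ℕ) :
    G.genusLaw.real {(i : ℝ)} = (G.partialDualCount i : ℝ) / 2 ^ G.numEdges := by
  classical
  rw [genusLaw, MeasureTheory.measureReal_def,
    PMF.toMeasure_apply_singleton _ _ (MeasurableSet.singleton _), PMF.map_apply, tsum_fintype]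
  simp only [PMF.uniformOfFintype_apply, Fintype.card_finset]
  rw [← Finset.sum_filter, Finset.sum_const, partialDualCount, Nat.card_eq_fintype_card,
    Fintype.card_subtype, numEdges, nsmul_eq_mul, ENNReal.toReal_mul, div_eq_mul_inv]
  have h : ∀ A : Finset G.Edge, ((i : ℝ) = ((G.partialDual A).genus : ℝ)) ↔
      (G.partialDual A).genus = (i : ℚ) := by
    intro A
    rw [eq_comm]
    exact_mod_cast Iff.rfl
  simp [h]

/-- The mean of the partial-dual genus distribution. -/
noncomputable def genusMean (G : RibbonGraph) : ℝ := ∫ y, y ∂G.genusLaw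

/-- The variance of the partial-dual genus distribution. -/
noncomputable def genusVariance (G : RibbonGraph) : ℝ :=
  ProbabilityTheory.variance (fun y : ℝ => y) G.genusLaw

/-- The standard normal distribution function. -/
noncomputable def normalCDF (x : ℝ) : ℝ :=
  ∫ u in Set.Iic x, 1 / √(2 * Real.pi) * Real.exp (-(1 / 2) * u ^ 2)

/-- The partial-dual genus distributions of `G 1, G 2, …` are asymptotically normal: after
subtracting the mean and dividing by the standard deviation, the distribution functions converge
pointwise to that of the standard normal law. -/
def AsymptoticallyNormal (G : ℕ → RibbonGraph) : Prop :=
  ∀ x : ℝ, Filter.Tendsto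
    (fun n => (G n).genusLaw.real {y | (y - (G n).genusMean) / √(G n).genusVariance ≤ x})
    Filter.atTop (nhds (normalCDF x))

/-- The oriented ribbon graph of a rotation system: the edge `e` has the two ends `(e, false)` and
`(e, true)`, and `next d` is the edge-end that follows `d` in the positive direction around its
vertex-disk. All arrows point in the positive direction. -/
def ofRotation (E : Type) [Fintype E] [DecidableEq E] (next : Equiv.Perm (E × Bool)) :
    RibbonGraph where
  Edge := E
  arc :=
    { toFun := fun p =>
        if p.2.2 then ((next (p.1, p.2.1)).1, (next (p.1, p.2.1)).2, false)
        else ((next.symm (p.1, p.2.1)).1, (next.symm (p.1, p.2.1)).2, true)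
      invFun := fun p =>
        if p.2.2 then ((next (p.1, p.2.1)).1, (next (p.1, p.2.1)).2, false)
        else ((next.symm (p.1, p.2.1)).1, (next.symm (p.1, p.2.1)).2, true)
      left_inv := by rintro ⟨e, i, t⟩; cases t <;> simp
      right_inv := by rintro ⟨e, i, t⟩; cases t <;> simp }
  arc_arc := by rintro ⟨e, i, t⟩; cases t <;> simp
  arc_ne := by
    rintro ⟨e, i, t⟩ h
    have h2 := congrArg (fun p : MarkedPoint E => p.2.2) h
    cases t <;> simp at h2
  isolated := 0

/-- The rotation system, in the plane, of the necklace graph with vertices `l i, r i` for `i` in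
the cyclically ordered set `Fin n`. The edges `(i, 0)` and `(i, 1)` join `l i` (end `false`) to
`r i` (end `true`), and the edge `(i, 2)` joins `r i` (end `false`) to `l (i + 1)` (end `true`).
Drawing `l i, r i, l (i + 1), …` from left to right, with `(i, 0)` above `(i, 1)`, the
counterclockwise order is `(i - 1, 2), (i, 1), (i, 0)` around `l i` and
`(i, 2), (i, 0), (i, 1)` around `r i`. -/
def necklaceNext (n : ℕ) : Equiv.Perm ((Fin n × Fin 3) × Bool) where
  toFun
    | ((i, 2), true) => ((finRotate n i, 1), false)
    | ((i, 1), false) => ((i, 0), false)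
    | ((i, 0), false) => (((finRotate n).symm i, 2), true)
    | ((i, 2), false) => ((i, 0), true)
    | ((i, 0), true) => ((i, 1), true)
    | ((i, 1), true) => ((i, 2), false)
  invFun
    | ((i, 1), false) => (((finRotate n).symm i, 2), true)
    | ((i, 0), false) => ((i, 1), false)
    | ((i, 2), true) => ((finRotate n i, 0), false)
    | ((i, 0), true) => ((i, 2), false)
    | ((i, 1), true) => ((i, 0), true)
    | ((i, 2), false) => ((i, 1), true)
  left_inv := by rintro ⟨⟨i, k⟩, s⟩; fin_cases k <;> cases s <;> simp [-finRotate_apply, -finRotate_symm_apply]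
  right_inv := by rintro ⟨⟨i, k⟩, s⟩; fin_cases k <;> cases s <;> simp [-finRotate_apply, -finRotate_symm_apply]

/-- The planar ribbon necklace graph `N_n`: a cycle of length `2n`, embedded in the plane, with
every second edge doubled. -/
def necklace (n : ℕ) : RibbonGraph := ofRotation (Fin n × Fin 3) (necklaceNext n)

end RibbonGraph

/-! The vertices and faces of `G^A` are the boundary components of the spanning subgraphs with edge
sets `A` and its complement. A number `k` of components is found from the `2 ^ k` two-colourings
constant on each component. On the necklace these colourings are counted by a transfer matrix: cut
at the single edges, where two boundary arcs pass from one bead to the next. A bead acts, up to a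
power of 2, as the identity (both arcs pass) or as a rank-one matrix (both arcs turn back), so the
trace of the product is explicit (`trace_prod_transfer`).

Euler's formula then gives genus = 1 + M - I - J (`genus_partialDual_necklace`). Here M counts the
beads with exactly one of their parallel edges in `A`, and I, J indicate that every bead of `A`,
respectively of its complement, lets both arcs pass. For uniform `A`, M is binomial with parameters
n and 1/2, while I and J are disjoint events of probability (3/8)^n each. This gives the exact mean
and variance. It also puts the characteristic function within 4(3/8)^n of the binomial one,
uniformly in the argument, and the cosine limit with Lévy's continuity theorem yields the normal
law. -/

/-- The number of classes of a relation on a finite type, through two-colourings. -/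
theorem two_pow_card_quot {α : Type} [Finite α] (r : α → α → Prop) :
    2 ^ Nat.card (Quot r) = Nat.card {c : α → Bool // ∀ p q, r p q → c p = c q} := by
  have e : (Quot r → Bool) ≃ {c : α → Bool // ∀ p q, r p q → c p = c q} :=
    { toFun := fun f => ⟨fun a => f (Quot.mk r a), fun p q h => congrArg f (Quot.sound h)⟩
      invFun := fun c => Quot.lift c.1 c.2
      left_inv := fun f => by ext q; induction q using Quot.ind; rfl
      right_inv := fun c => rfl }
  rw [← Nat.card_congr e, Nat.card_fun]
  simp

/-- Sums over cyclic words of products of matrix entries are traces. -/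
theorem sum_prod_mul_eq_trace {X R : Type*} [Fintype X] [DecidableEq X] [CommSemiring R] (n : ℕ)
    (M : Fin n → Matrix X X R) (N : Matrix X X R) :
    ∑ x : Fin (n + 1) → X, (∏ i : Fin n, M i (x i.castSucc) (x i.succ)) * N (x (Fin.last n)) (x 0) =
      ((List.ofFn M).prod * N).trace := by
  induction n generalizing N with
  | zero =>
    rw [← (Equiv.funUnique (Fin 1) X).symm.sum_comp]
    simp [Matrix.trace]
  | succ n ih =>
    -- Cyclicity of the trace moves the first matrix behind `N`, so the induction hypothesis is used
    -- with `N * M 0`.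
    rw [List.ofFn_succ, List.prod_cons, Matrix.mul_assoc, Matrix.trace_mul_comm, Matrix.mul_assoc,
      ← ih, ← (Fin.consEquiv fun _ => X).sum_comp, Fintype.sum_prod_type, Finset.sum_comm]
    refine Finset.sum_congr rfl fun x _ => ?_
    rw [Matrix.mul_apply, Finset.mul_sum]
    refine Finset.sum_congr rfl fun y _ => ?_
    simp [Fin.consEquiv, Fin.prod_univ_succ, ← Fin.succ_last, ← Fin.succ_castSucc, -Fin.castSucc_succ]
    ring

/-! ### Vertices and faces of a partial dual as boundary components -/

namespace RibbonGraph

section Rotation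

variable {E : Type} [Fintype E] [DecidableEq E]

/-- Exchange the two ends of the edges selected by `b`. -/
def swapEnds {E : Type} (b : E → Bool) (d : E × Bool) : E × Bool := (d.1, xor d.2 (b d.1))

/-- The two-colourings of the boundary components of the spanning subgraph whose edges are selected
by `b`. -/
abbrev FaceColoring {E : Type} (next : Equiv.Perm (E × Bool)) (b : E → Bool) : Type :=
  {h : E × Bool → Bool // ∀ d, h (swapEnds b (next d)) = h d}

/-- Transporting by `newArrow A` restores the original arcs and turns `mate` into a map that
exchanges heads and tails, switching the two ends of an edge exactly where `b` holds. Each tail is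
thus matched with one head, so a colouring is its values at the heads, and only the arcs impose
conditions. Vertices and faces are the two choices of `mate`. -/
theorem two_pow_card_quot_conj (next : Equiv.Perm (E × Bool)) (A : Finset E) (b : E → Bool)
    (mate arc : MarkedPoint E → MarkedPoint E)
    (hmate : ∀ p : MarkedPoint E, newArrow A (mate p) =
      ((newArrow A p).1, xor (newArrow A p).2.1 (b (newArrow A p).1),
        !(newArrow A p).2.2))
    (hhead : ∀ d : E × Bool, arc (d.1, d.2, true) = ((next d).1, (next d).2, false))
    (htail : ∀ d : E × Bool, arc (d.1, d.2, false) =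
      ((next.symm d).1, (next.symm d).2, true)) :
    2 ^ Nat.card (Quot fun p q : MarkedPoint E =>
        q = mate p ∨ q = (newArrow A).symm (arc (newArrow A p))) =
      Nat.card (FaceColoring next b) := by
  rw [two_pow_card_quot]
  have hm (e : E) (i t : Bool) : mate ((newArrow A).symm (e, i, t)) =
      (newArrow A).symm (e, xor i (b e), !t) := by
    rw [Equiv.eq_symm_apply, hmate]; simp
  refine Nat.card_congr
    { toFun := fun c => ⟨fun d => c.1 ((newArrow A).symm (d.1, d.2, true)), fun d => ?_⟩
      invFun := fun h => ⟨fun p => if (newArrow A p).2.2 then h.1 ((newArrow A p).1, (newArrow A p).2.1)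
        else h.1 (swapEnds b ((newArrow A p).1, (newArrow A p).2.1)), ?_⟩
      left_inv := ?_
      right_inv := ?_ }
  · have h1 := c.2 ((newArrow A).symm (d.1, d.2, true)) _ (.inr rfl)
    rw [Equiv.apply_symm_apply, hhead] at h1
    have h2 := c.2 _ _ (.inl (hm (next d).1 (next d).2 false).symm)
    exact (h1.trans h2).symm
  · rintro p q (rfl | rfl)
    · beta_reduce
      rw [hmate]
      rcases newArrow A p with ⟨e, i, t⟩
      cases t <;> simp [swapEnds]
    · beta_reduce
      rw [Equiv.apply_symm_apply]
      rcases newArrow A p with ⟨e, i, t⟩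
      cases t
      · have := h.2 (next.symm (e, i))
        rw [Equiv.apply_symm_apply] at this
        simpa [htail (e, i)] using this
      · have := h.2 (e, i)
        simpa [hhead (e, i)] using this.symm
  · intro c
    ext p
    obtain ⟨⟨e, i, t⟩, rfl⟩ := (newArrow A).symm.surjective p
    cases t
    · have := c.2 _ _ (.inl (hm e i false).symm)
      simpa [swapEnds] using this.symm
    · simp
  · intro h
    ext d
    simp

/-- An arrow of `G^A` is an old arrow for `e ∉ A` and an old ribbon side for `e ∈ A`; for faces the
two roles are interchanged. -/
theorem two_pow_numVertices_partialDual (next : Equiv.Perm (E × Bool)) (A : Finset E) :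
    2 ^ ((ofRotation E next).partialDual A).numVertices = Nat.card (FaceColoring next fun e => decide (e ∈ A)) :=
  two_pow_card_quot_conj next A _ arrowEnd (ofRotation E next).arc
    (by rintro ⟨e, i, t⟩
        by_cases h : e ∈ A <;> cases i <;> cases t <;> simp [newArrow, arrowEnd, h])
    (fun _ => rfl) fun _ => rfl

theorem two_pow_numFaces_partialDual (next : Equiv.Perm (E × Bool)) (A : Finset E) :
    2 ^ ((ofRotation E next).partialDual A).numFaces = Nat.card (FaceColoring next fun e => !decide (e ∈ A)) :=
  two_pow_card_quot_conj next A _ sideEnd (ofRotation E next).arc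
    (by rintro ⟨e, i, t⟩
        by_cases h : e ∈ A <;> cases i <;> cases t <;> simp [newArrow, sideEnd, h])
    (fun _ => rfl) fun _ => rfl

end Rotation

/-! ### The transfer matrix of a bead -/

/-- The membership of the three edges of a bead in an edge set. -/
abbrev BeadState : Type := Bool × Bool × Bool

namespace BeadState

/-- Both the double edge and the single edge of the bead are crossed. -/
def linked (s : BeadState) : Bool := s.2.2 && (s.1 || s.2.1)

/-- The boundary components inside the bead. -/
def loops (s : BeadState) : ℕ :=
  if s.1 && s.2.1 || !s.1 && !s.2.1 && !s.2.2 then 1 else 0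

/-- The equations for the colours `g` of the edge-ends of a bead, with the colours `x` and `y` of
the two boundary arcs entering on the left and leaving on the right. -/
def Compatible (s : BeadState) (x y : Bool × Bool) (g : Fin 3 × Bool → Bool) : Prop :=
  g (1, s.2.1) = x.1 ∧ g (0, s.1) = g (1, false) ∧ x.2 = g (0, false) ∧
  g (0, !s.1) = g (2, false) ∧ g (1, !s.2.1) = g (0, true) ∧ g (2, s.2.2) = g (1, true) ∧
  y.1 = g (2, true) ∧ y.2 = g (2, !s.2.2)

instance (s : BeadState) (x y : Bool × Bool) : DecidablePred (Compatible s x y) := fun _ => by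
  unfold Compatible; infer_instance

/-- The colours of the six edge-ends of a bead, in a table. -/
def colorTable :
    (Fin 3 × Bool → Bool) ≃ (Bool × Bool) × (Bool × Bool) × (Bool × Bool) where
  toFun g := ((g (0, false), g (0, true)), (g (1, false), g (1, true)), (g (2, false), g (2, true)))
  invFun v p :=
    let w := ![v.1, v.2.1, v.2.2] p.1
    if p.2 then w.2 else w.1
  left_inv g := by
    ext ⟨k, t⟩; fin_cases k <;> cases t <;> rfl
  right_inv _ := rfl

/-- A linked bead carries both arcs through, forcing `x = y`; an unlinked one joins the two arcs on
each side separately. Each closed inner component has a free colour, whence the power of 2. -/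
theorem sum_compatible : ∀ (s : BeadState) (x y : Bool × Bool),
    (∑ v, if s.Compatible x y (colorTable.symm v) then 1 else 0) =
      2 ^ s.loops * if s.linked then (if x = y then 1 else 0)
        else if x.1 = x.2 ∧ y.1 = y.2 then 1 else 0 := by
  decide +kernel

/-- The transfer matrix of an unlinked bead, up to a scalar. -/
def diagonalPairs : Matrix (Bool × Bool) (Bool × Bool) ℕ :=
  Matrix.of fun x y => if x.1 = x.2 ∧ y.1 = y.2 then 1 else 0

/-- The transfer matrix of a bead. -/
def transfer (s : BeadState) : Matrix (Bool × Bool) (Bool × Bool) ℕ :=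
  (2 ^ s.loops : ℕ) • if s.linked then 1 else diagonalPairs

theorem card_compatible (s : BeadState) (x y : Bool × Bool) :
    Nat.card {g // Compatible s x y g} = s.transfer x y := by
  rw [Nat.card_eq_fintype_card, Fintype.card_subtype, Finset.card_filter,
    ← colorTable.symm.sum_comp, sum_compatible, transfer]
  by_cases h : s.linked <;> simp [h, diagonalPairs, Matrix.one_apply]

/-- The number of boundary components that a bead contributes, apart from those that run along all
beads. -/
def faces (s : BeadState) : ℕ := s.loops + if s.linked then 0 else 1

theorem diagonalPairs_mul_self : diagonalPairs * diagonalPairs = (2 : ℕ) • diagonalPairs := by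
  ext x y
  revert x y
  decide +kernel

/-- If all beads are linked, the product is a multiple of the 4 × 4 identity, and the trace 4 = 2²
records two components running around the whole necklace. Otherwise the product is a multiple of
`diagonalPairs`. -/
theorem trace_prod_transfer (l : List BeadState) :
    (l.map transfer).prod.trace =
      2 ^ ((l.map faces).sum + if ∀ s ∈ l, s.linked then 2 else 0) := by
  -- With k ≥ 1 unlinked beads, D^k = 2^(k-1) D for D = `diagonalPairs`, whereas `faces` accounts
  -- for 2^k; the factor 2 on the left avoids a subtraction in the exponent.
  have key : (∀ s ∈ l, s.linked) ∧ (l.map transfer).prod = (2 ^ (l.map faces).sum : ℕ) • 1 ∨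
      ¬ (∀ s ∈ l, s.linked) ∧ (2 : ℕ) • (l.map transfer).prod =
        (2 ^ (l.map faces).sum : ℕ) • diagonalPairs := by
    induction l with
    | nil => simp
    | cons s l ih =>
      rw [List.map_cons, List.prod_cons, List.map_cons, List.sum_cons]
      cases hs : s.linked
      · right
        refine ⟨by simp [hs], ?_⟩
        rcases ih with ⟨-, h⟩ | ⟨-, h⟩
        · rw [h, transfer, faces, hs]
          simp only [Matrix.mul_smul, Matrix.mul_one, smul_smul]
          congr 1
          simp; ring
        · rw [← Matrix.mul_smul, h, transfer, faces, hs]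
          simp only [Matrix.smul_mul, Matrix.mul_smul, diagonalPairs_mul_self, smul_smul,
            Bool.false_eq_true, if_false]
          congr 1
          ring
      · rcases ih with ⟨h', h⟩ | ⟨h', h⟩
        · left
          refine ⟨by simpa [hs] using h', ?_⟩
          rw [h, transfer, faces, hs]
          simp only [if_true, Matrix.mul_smul, Matrix.mul_one, smul_smul]
          congr 1
          ring
        · right
          refine ⟨by simpa [hs] using h', ?_⟩
          rw [← Matrix.mul_smul, h, transfer, faces, hs]
          simp only [Matrix.smul_mul, if_true, Matrix.mul_smul, Matrix.one_mul, smul_smul]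
          congr 1
          ring
  rcases key with ⟨h', h⟩ | ⟨h', h⟩
  · rw [h, if_pos h', Matrix.trace_smul, Matrix.trace_one, pow_add]
    rfl
  · have h2 := congrArg Matrix.trace h
    have hd : diagonalPairs.trace = 2 := by decide
    rw [Matrix.trace_smul, Matrix.trace_smul, hd] at h2
    rw [if_neg h', add_zero]
    simp only [smul_eq_mul] at h2
    linarith

end BeadState

/-! ### Boundary components and connectedness of the necklace -/

/-- Once the colours `x i` of the two arcs entering each bead are fixed, the beads are coloured
independently; summing over `x` gives a trace. -/
theorem card_faceColoring_necklace (n : ℕ) (b : Fin (n + 1) × Fin 3 → Bool)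
    (s : Fin (n + 1) → BeadState) (hs : ∀ i, s i = (b (i, 0), b (i, 1), b (i, 2))) :
    Nat.card (FaceColoring (necklaceNext (n + 1)) b) =
      2 ^ (∑ i, (s i).faces + if ∀ i, (s i).linked then 2 else 0) := by
  classical
  let P (x : Fin (n + 1) → Bool × Bool) (i : Fin (n + 1)) (g : Fin 3 × Bool → Bool) : Prop :=
    (s i).Compatible (x i) (x (finRotate (n + 1) i)) g
  have e : FaceColoring (necklaceNext (n + 1)) b ≃
      {p : (Fin (n + 1) → Bool × Bool) × (Fin (n + 1) → Fin 3 × Bool → Bool) //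
        ∀ i, P p.1 i (p.2 i)} :=
    { toFun := fun h => ⟨(fun i => (h.1 (((finRotate (n + 1)).symm i, 2), true),
          h.1 (((finRotate (n + 1)).symm i, 2), !b ((finRotate (n + 1)).symm i, 2))),
          fun i d => h.1 ((i, d.1), d.2)), by
        intro i
        have h0 := h.2 (((finRotate (n + 1)).symm i, 2), true)
        have h1 := h.2 ((i, 1), false)
        have h2 := h.2 ((i, 0), false)
        have h3 := h.2 ((i, 2), false)
        have h4 := h.2 ((i, 0), true)
        have h5 := h.2 ((i, 1), true)
        simp [necklaceNext, swapEnds, -finRotate_apply, -finRotate_symm_apply] at h0 h1 h2 h3 h4 h5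
        simp [P, hs, BeadState.Compatible, -finRotate_apply, -finRotate_symm_apply, h0, h1, h2, h3,
          h4, h5]⟩
      invFun := fun p => ⟨fun d => p.1.2 d.1.1 (d.1.2, d.2), by
        rintro ⟨⟨i, k⟩, t⟩
        have h1 := p.2 i
        have h2 := p.2 (finRotate (n + 1) i)
        have h3 := p.2 ((finRotate (n + 1)).symm i)
        simp only [P, hs, BeadState.Compatible, Equiv.apply_symm_apply] at h1 h2 h3
        fin_cases k <;> cases t <;>
          simp [necklaceNext, swapEnds, -finRotate_apply, -finRotate_symm_apply] <;>
          grind only⟩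
      left_inv := fun h => rfl
      -- The family `x` is redundant: the last two equations of `Compatible` for the preceding bead
      -- recover it.
      right_inv := fun p => by
        refine Subtype.ext (Prod.ext (funext fun i => ?_) rfl)
        have h3 := p.2 ((finRotate (n + 1)).symm i)
        simp only [P, hs, BeadState.Compatible, Equiv.apply_symm_apply] at h3
        simp [h3, Prod.ext_iff, -finRotate_apply, -finRotate_symm_apply] }
  rw [Nat.card_congr e, Nat.card_congr (Equiv.subtypeProdEquivSigmaSubtype
    fun x (g : Fin (n + 1) → Fin 3 × Bool → Bool) => ∀ i, P x i (g i)), Nat.card_sigma]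
  have h1 (x : Fin (n + 1) → Bool × Bool) :
      Nat.card {g : Fin (n + 1) → Fin 3 × Bool → Bool // ∀ i, P x i (g i)} =
        ∏ i, (s i).transfer (x i) (x (finRotate (n + 1) i)) := by
    rw [Nat.card_congr (Equiv.subtypePiEquivPi (p := fun {i} g => P x i g)), Nat.card_pi]
    exact Finset.prod_congr rfl fun i _ => BeadState.card_compatible _ _ _
  simp_rw [h1, Fin.prod_univ_castSucc, finRotate_last]
  have h2 := sum_prod_mul_eq_trace n (fun i => (s i.castSucc).transfer)
    (s (Fin.last n)).transfer
  have h3 : (List.ofFn fun i : Fin n => (s i.castSucc).transfer).prod *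
      (s (Fin.last n)).transfer = ((List.ofFn s).map BeadState.transfer).prod := by
    rw [List.map_ofFn, List.ofFn_succ_last, List.prod_append]
    simp
  rw [h3, BeadState.trace_prod_transfer, List.map_ofFn, List.sum_ofFn] at h2
  simp only [List.forall_mem_ofFn_iff, Function.comp_def] at h2
  rw [← h2]
  simp

theorem quot_mk_eq_of_edge_eq {E : Type} {r : MarkedPoint E → MarkedPoint E → Prop}
    (harrow : ∀ p, r p (arrowEnd p)) (hside : ∀ p, r p (sideEnd p)) (p q : MarkedPoint E)
    (h : p.1 = q.1) : Quot.mk r p = Quot.mk r q := by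
  have key (e : E) (i t : Bool) : Quot.mk r (e, i, t) = Quot.mk r (e, false, false) := by
    have h1 := Quot.sound (harrow (e, false, false))
    have h2 := Quot.sound (harrow (e, true, false))
    have h3 := Quot.sound (hside (e, false, false))
    simp only [arrowEnd, sideEnd, Bool.not_false] at h1 h2 h3
    cases i <;> cases t <;> simp_all
  obtain ⟨e, i, t⟩ := p
  obtain ⟨e', i', t'⟩ := q
  obtain rfl : e = e' := h
  rw [key e i t, key e i' t']

/-- `newArrow A` never changes the edge label, so edges adjacent in the rotation of the necklace
stay in one component of the dual. -/
theorem numComponents_partialDual_necklace (n : ℕ)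
    (A : Finset (Fin (n + 1) × Fin 3)) :
    ((necklace (n + 1)).partialDual A).numComponents = 1 := by
  set G := (necklace (n + 1)).partialDual A
  let r : MarkedPoint (Fin (n + 1) × Fin 3) → MarkedPoint (Fin (n + 1) × Fin 3) → Prop :=
    fun p q => q = arrowEnd p ∨ q = sideEnd p ∨ q = G.arc p
  have hedge := quot_mk_eq_of_edge_eq (r := r) (fun p => .inl rfl) (fun p => .inr (.inl rfl))
  have hfst (p : MarkedPoint (Fin (n + 1) × Fin 3)) : (newArrow A p).1 = p.1 := by
    simp only [newArrow, Equiv.coe_fn_mk]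
    split_ifs <;> rfl
  have hfst' (p : MarkedPoint (Fin (n + 1) × Fin 3)) : ((newArrow A).symm p).1 = p.1 := by
    rw [← hfst, Equiv.apply_symm_apply]
  have hnext (d : (Fin (n + 1) × Fin 3) × Bool) :
      Quot.mk r ((necklaceNext (n + 1) d).1, false, false) = Quot.mk r (d.1, false, false) := by
    have h := Quot.sound (r := r) (.inr (.inr rfl) :
      r ((newArrow A).symm (d.1, d.2, true)) (G.arc ((newArrow A).symm (d.1, d.2, true))))
    rw [hedge ((newArrow A).symm (d.1, d.2, true)) (d.1, false, false) (hfst' _)] at h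
    rw [h]
    refine hedge _ _ ?_
    change _ = ((newArrow A).symm ((necklace (n + 1)).arc
      (newArrow A ((newArrow A).symm (d.1, d.2, true))))).1
    rw [Equiv.apply_symm_apply]
    exact (hfst' ((necklace (n + 1)).arc (d.1, d.2, true))).symm
  have hbead (i : Fin (n + 1)) (k : Fin 3) :
      Quot.mk r ((i, k), false, false) = Quot.mk r ((i, 0), false, false) := by
    have h1 := hnext ((i, 1), false)
    have h2 := hnext ((i, 2), false)
    fin_cases k
    · rfl
    · exact h1.symm
    · exact h2.symm
  have hrot (i : Fin (n + 1)) : Quot.mk r ((finRotate (n + 1) i, 0), false, false) =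
      Quot.mk r ((i, 0), false, false) := by
    rw [← hbead _ 1, ← hbead i 2]
    exact hnext ((i, 2), true)
  have hzero (i : Fin (n + 1)) : Quot.mk r ((i, 0), false, false) =
      Quot.mk r ((0, 0), false, false) := by
    induction i using Fin.induction with
    | zero => rfl
    | succ i ih => rw [← ih, ← hrot i.castSucc]; simp
  have hall (p : MarkedPoint (Fin (n + 1) × Fin 3)) :
      Quot.mk r p = Quot.mk r ((0, 0), false, false) := by
    rw [hedge p (p.1, false, false) rfl, ← hzero p.1.1, ← hbead p.1.1 p.1.2]
  have hcard : Nat.card (Quot r) = 1 := by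
    refine Nat.card_eq_one_iff_unique.2 ⟨⟨fun p q => ?_⟩, ⟨Quot.mk r ((0, 0), false, false)⟩⟩
    induction p using Quot.ind
    induction q using Quot.ind
    rw [hall, ← hall]
  exact congrArg (· + 0) hcard

/-! ### The genus formula -/

namespace BeadState

/-- The state of the bead in the complementary edge set. -/
def compl (s : BeadState) : BeadState := (!s.1, !s.2.1, !s.2.2)

/-- Exactly one of the two parallel edges is selected. -/
def mixed (s : BeadState) : Bool := xor s.1 s.2.1

/-- The 3 is the number of edges of a bead, so the edge count cancels in Euler's formula. -/
theorem faces_add_faces_compl : ∀ s : BeadState,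
    s.faces + s.compl.faces + 2 * (if s.mixed then 1 else 0) = 3 := by
  decide

end BeadState

/-- The bead states of an edge set of the necklace. -/
def beadStates {n : ℕ} : Finset (Fin n × Fin 3) ≃ (Fin n → BeadState) where
  toFun A i := (decide ((i, 0) ∈ A), decide ((i, 1) ∈ A), decide ((i, 2) ∈ A))
  invFun s := Finset.univ.filter fun d => ![(s d.1).1, (s d.1).2.1, (s d.1).2.2] d.2
  left_inv A := by
    ext ⟨i, k⟩
    fin_cases k <;> simp
  right_inv s := by
    ext i <;> simp

/-- The genus of a partial dual of the necklace, in terms of the bead states. -/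
def beadGenus {n : ℕ} (s : Fin n → BeadState) : ℤ :=
  1 + ∑ i, (if (s i).mixed then 1 else 0) - (if ∀ i, (s i).linked then 1 else 0) -
    (if ∀ i, (s i).compl.linked then 1 else 0)

theorem genus_partialDual_necklace (n : ℕ) (A : Finset (Fin (n + 1) × Fin 3)) :
    ((necklace (n + 1)).partialDual A).genus = beadGenus (beadStates A) := by
  have hv : ((necklace (n + 1)).partialDual A).numVertices = _ :=
    Nat.pow_right_injective le_rfl ((two_pow_numVertices_partialDual _ A).trans
      (card_faceColoring_necklace n _ (beadStates A) fun _ => rfl))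
  have hf : ((necklace (n + 1)).partialDual A).numFaces = _ :=
    Nat.pow_right_injective le_rfl ((two_pow_numFaces_partialDual _ A).trans
      (card_faceColoring_necklace n _ (fun i => (beadStates A i).compl) fun _ => rfl))
  have he : ((necklace (n + 1)).partialDual A).numEdges = (n + 1) * 3 := by
    change Fintype.card (Fin (n + 1) × Fin 3) = _
    simp
  have hsum : ∑ i, (beadStates A i).faces + ∑ i, (beadStates A i).compl.faces +
      2 * ∑ i, (if (beadStates A i).mixed then 1 else 0) = (n + 1) * 3 := by
    rw [Finset.mul_sum, ← Finset.sum_add_distrib, ← Finset.sum_add_distrib]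
    simp only [BeadState.faces_add_faces_compl]
    simp
  rw [genus, hv, hf, he, numComponents_partialDual_necklace, beadGenus]
  have hsum' := congrArg (Nat.cast (R := ℚ)) hsum
  push_cast at hsum' ⊢
  split_ifs <;> linarith

/-- The law of the genus, as an average over the bead states. -/
theorem integral_genusLaw_necklace {F : Type*} [NormedAddCommGroup F] [NormedSpace ℝ F]
    [CompleteSpace F]
    {n : ℕ} (hn : n ≠ 0) {f : ℝ → F} (hf : Continuous f) :
    ∫ y, f y ∂(necklace n).genusLaw =
      ((8 : ℝ) ^ n)⁻¹ • ∑ s : Fin n → BeadState, f (beadGenus s) := by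
  obtain ⟨k, rfl⟩ := Nat.exists_eq_succ_of_ne_zero hn
  let E : Type := Fin (k + 1) × Fin 3
  let _ : MeasurableSpace (Finset E) := ⊤
  let X : Finset E → ℝ := fun A => (((necklace (k + 1)).partialDual A).genus : ℝ)
  have hlaw : (necklace (k + 1)).genusLaw =
      ((PMF.uniformOfFintype (Finset E)).toMeasure).map X :=
    (PMF.toMeasure_map _ _ (measurable_from_top (f := X))).symm
  rw [hlaw, MeasureTheory.integral_map (measurable_from_top (f := X)).aemeasurable
    hf.aestronglyMeasurable, ← beadStates.sum_comp, Finset.smul_sum]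
  rw [PMF.integral_eq_sum]
  refine Finset.sum_congr rfl fun A _ => ?_
  congr 1
  · have : Fintype.card E = 3 * (k + 1) := by simp [E, mul_comm]
    rw [PMF.uniformOfFintype_apply, Fintype.card_finset, this, pow_mul]
    norm_num
  · simp only [X]
    rw [genus_partialDual_necklace]
    simp

end RibbonGraph

/-! ### Exact mean and variance -/

/-- Sums over words of products of weights, the first moment of an additive statistic, and its
second moment. -/
theorem sum_prod_moments {S : Type*} [Fintype S] (f g : S → ℝ) {G a b : ℝ} (hG : ∑ s, g s = G)
    (ha : ∑ s, f s * g s = G * a) (hb : ∑ s, f s ^ 2 * g s = G * b) (n : ℕ) :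
    ∑ s : Fin n → S, ∏ i, g (s i) = G ^ n ∧
    ∑ s : Fin n → S, (∑ i, f (s i)) * ∏ i, g (s i) = n * a * G ^ n ∧
    ∑ s : Fin n → S, (∑ i, f (s i)) ^ 2 * ∏ i, g (s i) =
      (n * b + n * (n - 1) * a ^ 2) * G ^ n := by
  induction n with
  | zero => simp
  | succ n ih =>
    -- Split off the first letter. Here `a` and `b` are the first two moments of `f` under the
    -- weights `g / G`.
    obtain ⟨h0, h1, h2⟩ := ih
    have key (F : (Fin (n + 1) → S) → ℝ) : ∑ s, F s = ∑ x, ∑ s : Fin n → S, F (Fin.cons x s) := by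
      rw [← (Fin.consEquiv fun _ => S).sum_comp, Fintype.sum_prod_type]
      rfl
    simp only [key, Fin.prod_univ_succ, Fin.sum_univ_succ, Fin.cons_zero, Fin.cons_succ]
    have e1 (x : S) : ∑ s : Fin n → S, (f x + ∑ i, f (s i)) * (g x * ∏ i, g (s i)) =
        f x * g x * G ^ n + g x * (n * a * G ^ n) := by
      rw [← h1, ← h0, Finset.mul_sum, Finset.mul_sum, ← Finset.sum_add_distrib]
      exact Finset.sum_congr rfl fun s _ => by ring
    have e2 (x : S) : ∑ s : Fin n → S, (f x + ∑ i, f (s i)) ^ 2 * (g x * ∏ i, g (s i)) =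
        f x ^ 2 * g x * G ^ n + f x * g x * (2 * (n * a * G ^ n)) +
          g x * ((n * b + n * (n - 1) * a ^ 2) * G ^ n) := by
      rw [← h2, ← h1, ← h0]
      simp only [Finset.mul_sum, ← Finset.sum_add_distrib]
      exact Finset.sum_congr rfl fun s _ => by ring
    simp only [e1, e2, ← Finset.mul_sum, h0, Finset.sum_add_distrib, ← Finset.sum_mul, hG, ha, hb]
    push_cast
    refine ⟨by ring, by ring, by ring⟩

namespace RibbonGraph

open MeasureTheory Filter Topology

/-- The number of beads in which exactly one of the two parallel edges is selected. -/
def mixedCount {n : ℕ} (s : Fin n → BeadState) : ℝ := ∑ i, if (s i).mixed then 1 else 0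

/-- The indicator of the words whose letters all satisfy `p`. -/
def allIndicator (p : BeadState → Bool) {n : ℕ} (s : Fin n → BeadState) : ℝ :=
  ∏ i, if p (s i) then 1 else 0

theorem allIndicator_eq (p : BeadState → Bool) {n : ℕ} (s : Fin n → BeadState) :
    allIndicator p s = if ∀ i, p (s i) then 1 else 0 := by
  simp [allIndicator, Finset.prod_boole]

theorem allIndicator_sq (p : BeadState → Bool) {n : ℕ} (s : Fin n → BeadState) :
    allIndicator p s ^ 2 = allIndicator p s := by
  rw [allIndicator_eq]
  split_ifs <;> norm_num

/-- A linked bead contains its single edge, while a bead with linked complement omits it; `n ≠ 0`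
supplies a bead. -/
theorem allIndicator_mul_allIndicator {n : ℕ} (hn : n ≠ 0) (s : Fin n → BeadState) :
    allIndicator BeadState.linked s * allIndicator (fun t => t.compl.linked) s = 0 := by
  have h : ∀ t : BeadState, ¬ (t.linked ∧ t.compl.linked) := by decide
  rw [allIndicator_eq, allIndicator_eq]
  split_ifs with h1 h2
  · exact absurd ⟨h1 ⟨0, Nat.pos_of_ne_zero hn⟩, h2 ⟨0, Nat.pos_of_ne_zero hn⟩⟩ (h _)
  all_goals simp

theorem cast_beadGenus {n : ℕ} (s : Fin n → BeadState) :
    (beadGenus s : ℝ) = 1 + mixedCount s - allIndicator BeadState.linked s -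
      allIndicator (fun t => t.compl.linked) s := by
  rw [allIndicator_eq, allIndicator_eq, beadGenus, mixedCount]
  push_cast
  rfl

theorem sum_beadState (f : BeadState → ℝ) : ∑ s, f s =
    f (true, true, true) + f (true, true, false) + f (true, false, true) + f (true, false, false) +
    f (false, true, true) + f (false, true, false) + f (false, false, true) +
    f (false, false, false) := by
  simp only [Fintype.sum_prod_type, Fintype.sum_bool]
  ring

theorem moments_mixedCount (n : ℕ) :
    ∑ _s : Fin n → BeadState, (1 : ℝ) = 8 ^ n ∧
    ∑ s : Fin n → BeadState, mixedCount s = n / 2 * 8 ^ n ∧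
    ∑ s : Fin n → BeadState, mixedCount s ^ 2 = (n / 4 + n ^ 2 / 4) * 8 ^ n := by
  -- Four of the eight bead states are mixed.
  obtain ⟨h0, h1, h2⟩ := sum_prod_moments (fun t : BeadState => if t.mixed then 1 else 0)
    (fun _ => 1) (G := 8) (a := 1 / 2) (b := 1 / 2)
    (by rw [sum_beadState]; norm_num)
    (by rw [sum_beadState]; norm_num [BeadState.mixed])
    (by rw [sum_beadState]; norm_num [BeadState.mixed]) n
  simp only [Finset.prod_const_one, mul_one] at h0 h1 h2
  refine ⟨h0, h1.trans (by ring), h2.trans (by ring)⟩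

theorem moments_allIndicator (n : ℕ) (p : BeadState → Bool)
    (hp : p = BeadState.linked ∨ p = fun t => t.compl.linked) :
    ∑ s : Fin n → BeadState, allIndicator p s = 3 ^ n ∧
    ∑ s : Fin n → BeadState, mixedCount s * allIndicator p s = n * (2 / 3) * 3 ^ n := by
  -- Three states satisfy `p`, and two of these are mixed.
  obtain ⟨h0, h1, -⟩ := sum_prod_moments (fun t : BeadState => if t.mixed then 1 else 0)
    (fun t => if p t then 1 else 0) (G := 3) (a := 2 / 3) (b := 2 / 3)
    (by rcases hp with rfl | rfl <;> rw [sum_beadState] <;>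
          norm_num [BeadState.linked, BeadState.compl])
    (by rcases hp with rfl | rfl <;> rw [sum_beadState] <;>
          norm_num [BeadState.mixed, BeadState.linked, BeadState.compl])
    (by rcases hp with rfl | rfl <;> rw [sum_beadState] <;>
          norm_num [BeadState.mixed, BeadState.linked, BeadState.compl]) n
  exact ⟨h0, h1⟩

theorem genusMean_necklace {n : ℕ} (hn : n ≠ 0) :
    (necklace n).genusMean = ((n : ℝ) + 2) / 2 - 2 * (3 / 8 : ℝ) ^ n := by
  obtain ⟨h0, h1, -⟩ := moments_mixedCount n
  obtain ⟨i0, -⟩ := moments_allIndicator n _ (.inl rfl)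
  obtain ⟨j0, -⟩ := moments_allIndicator n _ (.inr rfl)
  rw [genusMean, integral_genusLaw_necklace hn continuous_id']
  simp only [cast_beadGenus, Finset.sum_sub_distrib, Finset.sum_add_distrib, h0, h1, i0, j0,
    smul_eq_mul, div_pow]
  field_simp
  ring

theorem genusVariance_necklace {n : ℕ} (hn : n ≠ 0) :
    (necklace n).genusVariance = (n : ℝ) / 4 + (2 - 2 * (n : ℝ) / 3) * (3 / 8 : ℝ) ^ n -
      4 * (3 / 8 : ℝ) ^ (2 * n) := by
  obtain ⟨h0, h1, h2⟩ := moments_mixedCount n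
  obtain ⟨i0, i1⟩ := moments_allIndicator n _ (.inl rfl)
  obtain ⟨j0, j1⟩ := moments_allIndicator n _ (.inr rfl)
  have hm : ∫ y, y ∂(necklace n).genusLaw = _ := genusMean_necklace hn
  rw [genusVariance, ProbabilityTheory.variance_eq_integral aemeasurable_id', hm,
    integral_genusLaw_necklace hn (by fun_prop)]
  generalize hc : ((n : ℝ) + 2) / 2 - 2 * (3 / 8 : ℝ) ^ n = c
  -- The square of 1 - c + M - I - J, reduced by I² = I, J² = J and IJ = 0.
  have key (s : Fin n → BeadState) : ((beadGenus s : ℝ) - c) ^ 2 =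
      (1 - c) ^ 2 * 1 + 2 * (1 - c) * mixedCount s + mixedCount s ^ 2 -
        (1 - 2 * c) * allIndicator BeadState.linked s -
        (1 - 2 * c) * allIndicator (fun t => t.compl.linked) s -
        2 * (mixedCount s * allIndicator BeadState.linked s) -
        2 * (mixedCount s * allIndicator (fun t => t.compl.linked) s) := by
    rw [cast_beadGenus]
    linear_combination allIndicator_sq BeadState.linked s +
      allIndicator_sq (fun t => t.compl.linked) s + 2 * allIndicator_mul_allIndicator hn s
  simp only [key, Finset.sum_sub_distrib, Finset.sum_add_distrib, ← Finset.mul_sum, h0, h1, h2,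
    i0, j0, i1, j1, smul_eq_mul]
  have h8 : (3 : ℝ) ^ n = 8 ^ n * (3 / 8) ^ n := by rw [← mul_pow]; norm_num
  rw [h8, ← hc, pow_mul']
  generalize (3 / 8 : ℝ) ^ n = q
  field_simp
  ring

/-! ### Characteristic functions and the normal limit -/

/-- The genus differs from 1 + M on at most 2 · 3^n of the 8^n words, and two unit exponentials
differ by at most 2. Uniformity in `t` is what allows arguments varying with n later. -/
theorem norm_charFun_genusLaw_necklace_sub_le {n : ℕ} (hn : n ≠ 0) (t : ℝ) :
    ‖charFun (necklace n).genusLaw t -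
      Complex.exp (t * Complex.I) * ((1 + Complex.exp (t * Complex.I)) / 2) ^ n‖ ≤
      4 * (3 / 8 : ℝ) ^ n := by
  have hK (s : Fin n → BeadState) : Complex.exp (t * (1 + mixedCount s : ℝ) * Complex.I) =
      Complex.exp (t * Complex.I) *
        ∏ i, if (s i).mixed then Complex.exp (t * Complex.I) else 1 := by
    have (i : Fin n) : (if (s i).mixed then Complex.exp (t * Complex.I) else 1) =
        Complex.exp ((if (s i).mixed then 1 else 0) * (t * Complex.I)) := by
      split_ifs <;> simp
    simp only [this]
    rw [← Complex.exp_sum, ← Complex.exp_add, ← Finset.sum_mul, mixedCount]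
    congr 1
    push_cast [apply_ite]
    ring
  have hsum : Complex.exp (t * Complex.I) * ((1 + Complex.exp (t * Complex.I)) / 2) ^ n =
      ((8 : ℝ) ^ n)⁻¹ •
        ∑ s : Fin n → BeadState, Complex.exp (t * (1 + mixedCount s : ℝ) * Complex.I) := by
    simp only [hK]
    rw [← Finset.mul_sum, ← Fintype.sum_pow
      (fun s : BeadState => if s.mixed then Complex.exp (t * Complex.I) else 1)]
    have : ∑ s : BeadState, (if s.mixed then Complex.exp (t * Complex.I) else 1) =
        8 * ((1 + Complex.exp (t * Complex.I)) / 2) := by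
      simp [Fintype.sum_prod_type, BeadState.mixed]
      ring
    rw [this, mul_pow, Complex.real_smul]
    push_cast
    field_simp
  have hterm (s : Fin n → BeadState) :
      ‖Complex.exp (t * (beadGenus s : ℝ) * Complex.I) -
        Complex.exp (t * (1 + mixedCount s : ℝ) * Complex.I)‖ ≤
      2 * (allIndicator BeadState.linked s + allIndicator (fun t => t.compl.linked) s) := by
    rw [cast_beadGenus, allIndicator_eq, allIndicator_eq]
    have h2 (a b : ℝ) : ‖Complex.exp (t * a * Complex.I) - Complex.exp (t * b * Complex.I)‖ ≤
        2 := by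
      refine (norm_sub_le _ _).trans ?_
      rw [← Complex.ofReal_mul, ← Complex.ofReal_mul, Complex.norm_exp_ofReal_mul_I,
        Complex.norm_exp_ofReal_mul_I]
      norm_num
    split_ifs
    · exact (h2 _ _).trans (by norm_num)
    · exact (h2 _ _).trans (by norm_num)
    · exact (h2 _ _).trans (by norm_num)
    · simp
  rw [charFun_apply_real, integral_genusLaw_necklace hn (by fun_prop), hsum, ← smul_sub,
    ← Finset.sum_sub_distrib, norm_smul, norm_inv, norm_pow, Real.norm_ofNat]
  refine (mul_le_mul_of_nonneg_left (norm_sum_le_of_le _ fun s _ => hterm s)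
    (by positivity)).trans_eq ?_
  rw [← Finset.mul_sum, Finset.sum_add_distrib, (moments_allIndicator n _ (.inl rfl)).1,
    (moments_allIndicator n _ (.inr rfl)).1, div_pow]
  field_simp
  ring

open MeasureTheory Filter Topology

instance isProbabilityMeasure_genusLaw (G : RibbonGraph) : IsProbabilityMeasure G.genusLaw := by
  unfold genusLaw
  infer_instance

theorem gaussianReal_real_Iic (x : ℝ) :
    (ProbabilityTheory.gaussianReal 0 1).real (Set.Iic x) = normalCDF x := by
  rw [measureReal_def, ProbabilityTheory.gaussianReal_apply_eq_integral 0 one_ne_zero,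
    ENNReal.toReal_ofReal (setIntegral_nonneg measurableSet_Iic fun _ _ =>
      ProbabilityTheory.gaussianPDFReal_nonneg _ _ _), normalCDF]
  refine setIntegral_congr_fun measurableSet_Iic fun u _ => ?_
  simp only [ProbabilityTheory.gaussianPDFReal, NNReal.coe_one, mul_one, sub_zero, one_div]
  congr 2
  ring

/-- Convergence of distribution functions to the standard normal one, from convergence of
characteristic functions. -/
theorem tendsto_real_Iic_of_tendsto_charFun {μ : ℕ → Measure ℝ}
    [∀ n, IsProbabilityMeasure (μ n)]
    (h : ∀ t : ℝ, Tendsto (fun n => charFun (μ n) t) atTop (𝓝 (Complex.exp (-(t ^ 2 / 2)))))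
    (x : ℝ) : Tendsto (fun n => (μ n).real (Set.Iic x)) atTop (𝓝 (normalCDF x)) := by
  let ν : ℕ → ProbabilityMeasure ℝ := fun n => ⟨μ n, inferInstance⟩
  let γ : ProbabilityMeasure ℝ := ⟨ProbabilityTheory.gaussianReal 0 1, inferInstance⟩
  have hν : Tendsto ν atTop (𝓝 γ) := by
    refine ProbabilityMeasure.tendsto_of_tendsto_charFun fun t => ?_
    simpa [ν, γ, ProbabilityTheory.charFun_gaussianReal] using h t
  have := ProbabilityTheory.nullSingletonClass_gaussianReal (μ := 0) (v := 1) one_ne_zero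
  have h2 := ProbabilityMeasure.tendsto_measure_of_null_frontier_of_tendsto' hν
    (E := Set.Iic x) (by rw [frontier_Iic]; exact this.measure_singleton x)
  rw [← gaussianReal_real_Iic]
  exact (ENNReal.tendsto_toReal (measure_ne_top _ _)).comp h2

/-- Since cos x = 1 - x²/2 + O(x⁴), n(cos x - 1) tends to -c/2; then (1 + z/n)^n → e^z applies. -/
theorem tendsto_cos_pow {x : ℕ → ℝ} {c : ℝ} (hx : Tendsto (fun n => n * x n ^ 2) atTop (𝓝 c)) :
    Tendsto (fun n => Real.cos (x n) ^ n) atTop (𝓝 (Real.exp (-(c / 2)))) := by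
  have hx2 : Tendsto (fun n => x n ^ 2) atTop (𝓝 0) := by
    have := hx.mul (tendsto_inv_atTop_nhds_zero_nat (𝕜 := ℝ))
    rw [mul_zero] at this
    refine this.congr' ?_
    filter_upwards [eventually_ne_atTop 0] with n hn
    field_simp
  have h4 : Tendsto (fun n => n * x n ^ 2 * x n ^ 2) atTop (𝓝 0) := by
    simpa using hx.mul hx2
  have h5 : Tendsto (fun n => n * (Real.cos (x n) - (1 - x n ^ 2 / 2))) atTop (𝓝 0) := by
    refine squeeze_zero_norm' ?_ h4
    filter_upwards [hx2.eventually (ge_mem_nhds one_pos)] with n hn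
    have hb := Real.cos_bound ((sq_le_one_iff_abs_le_one _).1 hn)
    rw [norm_mul, Real.norm_natCast, Real.norm_eq_abs, mul_assoc]
    refine mul_le_mul_of_nonneg_left (hb.trans ?_) n.cast_nonneg
    rw [Even.pow_abs (by decide)]
    nlinarith [sq_nonneg (x n ^ 2)]
  have h6 : Tendsto (fun n : ℕ => n * (Real.cos (x n) - 1)) atTop (𝓝 (-(c / 2))) := by
    have := h5.sub (hx.div_const 2)
    rw [zero_sub] at this
    refine this.congr fun n => ?_
    ring
  simpa using Real.tendsto_one_add_pow_exp_of_tendsto h6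

/-- Asymptotic normality of the genus, for all centerings and scalings that are close enough to
`(n + 2) / 2` and `n / 4`. -/
theorem tendsto_genusLaw_necklace {m v : ℕ → ℝ}
    (hm : Tendsto (fun n => m n - ((n : ℝ) + 2) / 2) atTop (𝓝 0))
    (hv : Tendsto (fun n => v n / n) atTop (𝓝 (1 / 4))) (x : ℝ) :
    Tendsto (fun n => (necklace n).genusLaw.real {y | (y - m n) / √(v n) ≤ x})
      atTop (𝓝 (normalCDF x)) := by
  have hmeas (n : ℕ) : Measurable fun y : ℝ => (√(v n))⁻¹ * (y + -m n) := by fun_prop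
  have hprob (n : ℕ) : IsProbabilityMeasure
      ((necklace n).genusLaw.map fun y => (√(v n))⁻¹ * (y + -m n)) :=
    Measure.isProbabilityMeasure_map (hmeas n).aemeasurable
  have hset (n : ℕ) : (necklace n).genusLaw.real {y | (y - m n) / √(v n) ≤ x} =
      ((necklace n).genusLaw.map fun y => (√(v n))⁻¹ * (y + -m n)).real (Set.Iic x) := by
    rw [map_measureReal_apply (hmeas n) measurableSet_Iic]
    congr 1
    ext y
    simp [div_eq_inv_mul, sub_eq_add_neg]
  simp only [hset]
  refine tendsto_real_Iic_of_tendsto_charFun (fun t => ?_) x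
  have hchar (n : ℕ) : charFun ((necklace n).genusLaw.map fun y => (√(v n))⁻¹ * (y + -m n)) t =
      charFun (necklace n).genusLaw ((√(v n))⁻¹ * t) *
        Complex.exp (-(m n * ((√(v n))⁻¹ * t) : ℝ) * Complex.I) := by
    rw [charFun_map_mul_comp (by fun_prop), charFun_map_add_const]
    congr 3
    simp
    ring
  simp only [hchar]
  set θ : ℕ → ℝ := fun n => (√(v n))⁻¹ * t with hθ
  -- Positivity is needed for `√(v n) ^ 2 = v n`.
  have hvpos : ∀ᶠ n in atTop, 0 < v n := by
    filter_upwards [hv.eventually (lt_mem_nhds (show (0 : ℝ) < 1 / 4 by norm_num))] with n hn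
    by_contra h
    exact absurd hn (not_lt.2 (div_nonpos_of_nonpos_of_nonneg (not_lt.1 h) n.cast_nonneg))
  have hθ2 : Tendsto (fun n => n * θ n ^ 2) atTop (𝓝 (4 * t ^ 2)) := by
    have := (hv.inv₀ (by norm_num)).mul_const (t ^ 2)
    norm_num at this
    refine this.congr' ?_
    filter_upwards [hvpos] with n hn
    rw [hθ]
    simp only [mul_pow, inv_pow, Real.sq_sqrt hn.le]
    ring
  have hθ0 : Tendsto θ atTop (𝓝 0) := by
    have := hθ2.mul (tendsto_inv_atTop_nhds_zero_nat (𝕜 := ℝ))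
    rw [mul_zero] at this
    have h2 : Tendsto (fun n => θ n ^ 2) atTop (𝓝 0) := by
      refine this.congr' ?_
      filter_upwards [eventually_ne_atTop 0] with n hn
      field_simp
    have h3 := h2.sqrt
    simp only [Real.sqrt_sq_eq_abs, Real.sqrt_zero] at h3
    exact tendsto_zero_iff_abs_tendsto_zero _ |>.2 h3
  have hmain : Tendsto (fun n : ℕ => Complex.exp (θ n * Complex.I) *
      ((1 + Complex.exp (θ n * Complex.I)) / 2) ^ n *
        Complex.exp (-(m n * θ n : ℝ) * Complex.I)) atTop (𝓝 (Complex.exp (-(t ^ 2 / 2)))) := by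
    have hcos := tendsto_cos_pow (x := fun n => θ n / 2) (c := t ^ 2) (by
      refine (hθ2.div_const 4).congr' (.of_forall fun n => ?_) |>.trans_eq ?_
      · ring
      · congr 1; ring)
    have hphase : Tendsto (fun n => Complex.exp ((-(θ n * (m n - ((n : ℝ) + 2) / 2)) : ℝ) *
        Complex.I)) atTop (𝓝 1) := by
      have h0 : Tendsto (fun n => -(θ n * (m n - ((n : ℝ) + 2) / 2))) atTop (𝓝 0) := by
        simpa using (hθ0.mul hm).neg
      have hc : Continuous fun u : ℝ => Complex.exp (u * Complex.I) := by fun_prop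
      simpa [Function.comp_def] using (hc.tendsto 0).comp h0
    have := hphase.mul (Complex.continuous_ofReal.tendsto _ |>.comp hcos)
    rw [one_mul] at this
    push_cast at this
    refine this.congr fun n => ?_
    -- The half-angle identity: the phases combine to θ((n + 2)/2 - m), which tends to 0, and
    -- cos(θ/2)^n remains.
    have e1 : (1 + Complex.exp (θ n * Complex.I)) / 2 =
        Complex.exp ((θ n / 2) * Complex.I) * Complex.cos (θ n / 2) := by
      rw [Complex.cos, mul_div_assoc', mul_add, ← Complex.exp_add, ← Complex.exp_add, add_comm]
      congr 2
      · congr 1; ring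
      · rw [← Complex.exp_zero]; congr 1; ring
    rw [e1, mul_pow, ← Complex.exp_nat_mul, mul_right_comm, ← mul_assoc, ← Complex.exp_add,
      ← Complex.exp_add]
    simp only [Function.comp_apply]
    push_cast
    congr 2
    ring
  have herr : Tendsto (fun n => (charFun (necklace n).genusLaw (θ n) -
      Complex.exp (θ n * Complex.I) * ((1 + Complex.exp (θ n * Complex.I)) / 2) ^ n) *
        Complex.exp (-(m n * θ n : ℝ) * Complex.I)) atTop (𝓝 0) := by
    have hgeom : Tendsto (fun n : ℕ => 4 * (3 / 8 : ℝ) ^ n) atTop (𝓝 0) := by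
      simpa using (tendsto_pow_atTop_nhds_zero_of_lt_one (r := (3 / 8 : ℝ)) (by norm_num)
        (by norm_num)).const_mul 4
    refine squeeze_zero_norm' ?_ hgeom
    filter_upwards [eventually_ne_atTop 0] with n hn
    rw [norm_mul, ← Complex.ofReal_neg, Complex.norm_exp_ofReal_mul_I, mul_one]
    exact norm_charFun_genusLaw_necklace_sub_le hn _
  have := herr.add hmain
  rw [zero_add] at this
  exact this.congr fun n => by simp only [hθ]; ring

end RibbonGraph

theorem mainTheorem8 :
    RibbonGraph.AsymptoticallyNormal RibbonGraph.necklace ∧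
    (∀ n : ℕ, 1 ≤ n →
      (RibbonGraph.necklace n).genusMean = ((n : ℝ) + 2) / 2 - 2 * (3 / 8 : ℝ) ^ n ∧
      (RibbonGraph.necklace n).genusVariance =
        (n : ℝ) / 4 + (2 - 2 * (n : ℝ) / 3) * (3 / 8 : ℝ) ^ n - 4 * (3 / 8 : ℝ) ^ (2 * n)) ∧
    (∀ x : ℝ, Filter.Tendsto
      (fun n : ℕ => (RibbonGraph.necklace n).genusLaw.real
        {y | (y - ((n : ℝ) + 2) / 2) / √((n : ℝ) / 4) ≤ x})
      Filter.atTop (nhds (RibbonGraph.normalCDF x))) := by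
  have hgeom : Filter.Tendsto (fun n : ℕ => (3 / 8 : ℝ) ^ n) Filter.atTop (nhds 0) :=
    tendsto_pow_atTop_nhds_zero_of_lt_one (by norm_num) (by norm_num)
  -- Both limit statements are the same lemma, with the exact and with the simplified mean and
  -- variance; the error terms vanish because n(3/8)^n, divided by n, tends to 0.
  refine ⟨fun x => RibbonGraph.tendsto_genusLaw_necklace ?_ ?_ x, fun n hn =>
    ⟨RibbonGraph.genusMean_necklace (by omega), RibbonGraph.genusVariance_necklace (by omega)⟩,
    fun x => RibbonGraph.tendsto_genusLaw_necklace ?_ ?_ x⟩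
  · have := hgeom.const_mul (-2)
    rw [mul_zero] at this
    refine this.congr' ?_
    filter_upwards [Filter.eventually_ne_atTop 0] with n hn
    rw [RibbonGraph.genusMean_necklace hn]
    ring
  · have hinv := tendsto_inv_atTop_nhds_zero_nat (𝕜 := ℝ)
    have := (((hinv.mul hgeom).const_mul 2).sub (hgeom.const_mul (2 / 3))).sub
      ((hinv.mul (hgeom.mul hgeom)).const_mul 4) |>.const_add (1 / 4)
    norm_num only [mul_zero, sub_zero, add_zero] at this
    refine this.congr' ?_
    filter_upwards [Filter.eventually_ne_atTop 0] with n hn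
    rw [RibbonGraph.genusVariance_necklace hn, pow_mul']
    generalize (3 / 8 : ℝ) ^ n = q
    field_simp
    ring
  · simp
  · refine tendsto_const_nhds.congr' ?_
    filter_upwards [Filter.eventually_ne_atTop 0] with n hn
    field_simp
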